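/- All digraphs are finite and simple (no loops, no multiple arcs). For a digraph $G$ and a real number $0\le\alpha<1$ let $A_\alpha(G)=\alpha D(G)+(1-\alpha)A(G)$, where $A(G)$ is the adjacency matrix and $D(G)$ the diagonal matrix of outdegrees of $G$, and let the $\alpha$-spectral radius $\rho_\alpha(G)$ be the spectral radius of $A_\alpha(G)$. Let $\overrightarrow{C_n}$ be the directed cycle on $n$ vertices, and let $\widetilde\Theta(k_1,\dots,k_s;l_1,\dots,l_t)$ be the digraph consisting of two vertices $u\ne v$, directed paths of lengths $k_1,\dots,k_s$ from $u$ to $v$ and directed paths of lengths $l_1,\dots,l_t$ from $v$ to $u$, all these paths being internally disjoint. Let $n\ge 4$ and $0\le\alpha<1$. Up to isomorphism, $\overrightarrow{C_n}$, $\widetilde\Theta(2,1;n-2)$ and $\widetilde\Theta(2,2;n-3)$ are, in this order, the unique digraphs with the smallest, second smallest and third smallest $\alpha$-spectral radius among all strongly connected digraphs on $n$ vertices. That is, these are strongly connected digraphs on $n$ vertices, $$\rho_\alpha(\overrightarrow{C_n})<\rho_\alpha(\widetilde\Theta(2,1;n-2))<\rho_\alpha(\widetilde\Theta(2,2;n-3)),$$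 and $\rho_\alpha(\widetilde\Theta(2,2;n-3))<\rho_\alpha(G)$ for every strongly connected digraph $G$ on $n$ vertices that is isomorphic to none of the three. If moreover $0\le\alpha\le\frac12$, then $\widetilde\Theta(3,1;n-3)$, which is also a strongly connected digraph on $n$ vertices, is up to isomorphism the unique digraph with the fourth smallest $\alpha$-spectral radius: $\rho_\alpha(\widetilde\Theta(2,2;n-3))<\rho_\alpha(\widetilde\Theta(3,1;n-3))$, and $\rho_\alpha(\widetilde\Theta(3,1;n-3))<\rho_\alpha(G)$ for every strongly connected digraph $G$ on $n$ vertices that is isomorphic to none of the four. -/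

import Mathlib

namespace AlphaSpectral

/-- `G` is a simple (loopless) strongly connected digraph on `n` vertices. Multiple arcs are
excluded since a `Digraph` is a relation. -/
def IsStrongOfOrder {V : Type*} [Fintype V] (n : ℕ) (G : Digraph V) : Prop :=
  Fintype.card V = n ∧ (∀ v, ¬ G.Adj v v) ∧ ∀ u v, Relation.ReflTransGen G.Adj u v

/-- Isomorphism of digraphs. -/
def Isomorphic {V W : Type*} (G : Digraph V) (H : Digraph W) : Prop :=
  Nonempty (G.Adj ≃r H.Adj)

open Classical in
/-- The adjacency matrix. -/
noncomputable def adjMatrix {V : Type*} (G : Digraph V) : Matrix V V ℝ :=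
  Matrix.of fun u v => if G.Adj u v then 1 else 0

open Classical in
/-- The outdegree of a vertex. -/
noncomputable def outdegree {V : Type*} [Fintype V] (G : Digraph V) (u : V) : ℕ :=
  (Finset.univ.filter fun v => G.Adj u v).card

/-- `A_α(G) = α D(G) + (1 - α) A(G)`, with `D(G)` the diagonal matrix of outdegrees. -/
noncomputable def alphaMatrix {V : Type*} [Fintype V] [DecidableEq V] (α : ℝ) (G : Digraph V) :
    Matrix V V ℝ :=
  α • Matrix.diagonal (fun v => (outdegree G v : ℝ)) + (1 - α) • adjMatrix G

/-- The `α`-spectral radius of `G`: the largest modulus of a complex eigenvalue of `A_α(G)`. -/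
noncomputable def alphaSpectralRadius {V : Type*} [Fintype V] [DecidableEq V] (α : ℝ)
    (G : Digraph V) : ENNReal :=
  spectralRadius ℂ ((alphaMatrix α G).map Complex.ofReal)

/-- The directed cycle on `n` vertices. -/
def dicycle (n : ℕ) : Digraph (Fin n) where
  Adj i j := (j : ℕ) = ((i : ℕ) + 1) % n

/-- The vertices of the generalized theta digraph: the two end vertices `u` (`false`) and `v`
(`true`), and the internal vertices of the paths. -/
abbrev ThetaVertex {s t : ℕ} (k : Fin s → ℕ) (l : Fin t → ℕ) : Type :=
  Bool ⊕ ((Σ i : Fin s, Fin (k i - 1)) ⊕ (Σ j : Fin t, Fin (l j - 1)))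

/-- The vertex at distance `p` from the start `u` on the `i`-th path from `u` to `v`. -/
def forwardVertex {s t : ℕ} (k : Fin s → ℕ) (l : Fin t → ℕ) (i : Fin s) (p : ℕ) :
    ThetaVertex k l :=
  if h : 0 < p ∧ p < k i then Sum.inr (Sum.inl ⟨i, ⟨p - 1, by omega⟩⟩)
  else if p = 0 then Sum.inl false else Sum.inl true

/-- The vertex at distance `p` from the start `v` on the `j`-th path from `v` to `u`. -/
def backwardVertex {s t : ℕ} (k : Fin s → ℕ) (l : Fin t → ℕ) (j : Fin t) (p : ℕ) :
    ThetaVertex k l :=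
  if h : 0 < p ∧ p < l j then Sum.inr (Sum.inr ⟨j, ⟨p - 1, by omega⟩⟩)
  else if p = 0 then Sum.inl true else Sum.inl false

/-- The generalized theta digraph `Θ̃(k₁, …, k_s; l₁, …, l_t)` (for positive path lengths):
internally disjoint directed paths of lengths `k₁, …, k_s` from `u` to `v` and of lengths
`l₁, …, l_t` from `v` to `u`. -/
def theta {s t : ℕ} (k : Fin s → ℕ) (l : Fin t → ℕ) : Digraph (ThetaVertex k l) where
  Adj x y :=
    (∃ i, ∃ p < k i, x = forwardVertex k l i p ∧ y = forwardVertex k l i (p + 1)) ∨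
    (∃ j, ∃ p < l j, x = backwardVertex k l j p ∧ y = backwardVertex k l j (p + 1))

end AlphaSpectral

/-! The proof rests on test vectors `v ↦ t ^ d v`, where `0 < t` and `d v` is the distance from `v`
to the set of branching vertices (outdegree at least 2). If `lam * t = α * t + (1 - α)`, then
`A_α(G) x ≥ lam x` holds automatically off the branching set: the next vertex on a shortest path
contributes `t ^ (d v - 1)`. The only real condition is at a branching vertex, where it suffices
that `lam ≤ 2 * α + (1 - α) * ∑ t ^ d w`, summed over out-neighbours. Collatz–Wielandt bounds turn
this into bounds for the spectral radius, strict when one row is strict, by irreducibility.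

In `Θ̃(a, b; l)` only `u` branches, and its two out-neighbours are at distances `l + a - 1` and `l +
b - 1` from it. Solving `lam = 2 * α + (1 - α) * (t ^ (l + a - 1) + t ^ (l + b - 1))` makes the test
vector a positive eigenvector. Comparing radii thus reduces to comparing exponent pairs at a fixed
`t < 1`: `(n - 1, n - 2)`, `(n - 2, n - 2)` and `(n - 1, n - 3)` give increasing sums, the last step
because `(1 - t) ^ 2 > 0`. The cycle has radius at most 1, and `t = 1` shows that the first theta
digraph exceeds 1.

For any other digraph, counting occupied distance levels bounds the distances of the out-neighbours.
With two branching vertices the sum exceeds `t ^ (n - 1) + t ^ (n - 3)`. With one, either some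
out-neighbour is at distance at most `n - 3`, which gives this bound with equality only for `Θ̃(3,
1; n - 3)`, or the levels force one of the first two theta digraphs. -/

namespace AlphaSpectral

open Matrix

/-! ### Collatz–Wielandt bounds for nonnegative matrices -/

section Perron

variable {V : Type*} [Fintype V] [DecidableEq V]

/-- Collatz–Wielandt upper bound: a positive vector with `M x ≤ μ x` bounds the spectral radius. -/
theorem spectralRadius_le_of_mulVec_le {M : Matrix V V ℝ} (hM : ∀ i j, 0 ≤ M i j) {x : V → ℝ}
    (hx : ∀ i, 0 < x i) {μ : ℝ} (h : ∀ i, (M *ᵥ x) i ≤ μ * x i) :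
    spectralRadius ℂ (M.map Complex.ofReal) ≤ ENNReal.ofReal μ := by
  refine iSup₂_le fun k hk => ?_
  have hdet : (algebraMap ℂ (Matrix V V ℂ) k - M.map Complex.ofReal).det = 0 := by
    by_contra hne
    exact hk ((Matrix.isUnit_iff_isUnit_det _).2 (isUnit_iff_ne_zero.2 hne))
  obtain ⟨z, hz0, hz⟩ := Matrix.exists_mulVec_eq_zero_iff.2 hdet
  have heig : ∀ i, k * z i = ∑ j, (M i j : ℂ) * z j := by
    intro i
    have := congrFun hz i
    rw [Matrix.sub_mulVec, Pi.sub_apply, Pi.zero_apply, sub_eq_zero, Algebra.algebraMap_eq_smul_one,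
      Matrix.smul_mulVec, Matrix.one_mulVec] at this
    simpa [Matrix.mulVec, dotProduct] using this
  obtain ⟨i₀, hi₀⟩ := Function.ne_iff.1 hz0
  -- At a row maximising `‖z i‖ / x i`, the vector `r • x` dominates `‖z‖` and touches it, so the
  -- eigenvalue equation there bounds `‖k‖`.
  obtain ⟨i, -, hi⟩ := Finset.exists_max_image Finset.univ (fun i => ‖z i‖ / x i)
    ⟨i₀, Finset.mem_univ _⟩
  set r := ‖z i‖ / x i with hr
  have hr0 : 0 < r := lt_of_lt_of_le (div_pos (norm_pos_iff.2 hi₀) (hx i₀)) (hi i₀ (Finset.mem_univ _))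
  have hzi : ‖z i‖ = r * x i := by rw [hr, div_mul_cancel₀ _ (hx i).ne']
  have hle : ‖k‖ * (r * x i) ≤ μ * (r * x i) := calc
    ‖k‖ * (r * x i) = ‖∑ j, (M i j : ℂ) * z j‖ := by rw [← heig, norm_mul, hzi]
    _ ≤ ∑ j, ‖(M i j : ℂ) * z j‖ := norm_sum_le _ _
    _ ≤ ∑ j, M i j * (r * x j) := by
      refine Finset.sum_le_sum fun j _ => ?_
      rw [norm_mul, Complex.norm_real, Real.norm_of_nonneg (hM i j)]
      exact mul_le_mul_of_nonneg_left ((div_le_iff₀ (hx j)).1 (hi j (Finset.mem_univ _))) (hM i j)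
    _ = r * (M *ᵥ x) i := by
      simp only [Matrix.mulVec, dotProduct, Finset.mul_sum]
      exact Finset.sum_congr rfl fun j _ => by ring
    _ ≤ r * (μ * x i) := mul_le_mul_of_nonneg_left (h i) hr0.le
    _ = μ * (r * x i) := by ring
  have hk' : ‖k‖ ≤ μ := le_of_mul_le_mul_right hle (mul_pos hr0 (hx i))
  rw [← enorm_eq_nnnorm, ← ofReal_norm]
  exact ENNReal.ofReal_le_ofReal hk'

theorem mulVec_mono {V : Type*} [Fintype V] {M : Matrix V V ℝ} (hM : ∀ i j, 0 ≤ M i j) {x y : V → ℝ} (h : ∀ i, x i ≤ y i)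
    (i : V) : (M *ᵥ x) i ≤ (M *ᵥ y) i :=
  Finset.sum_le_sum fun j _ => mul_le_mul_of_nonneg_left (h j) (hM i j)

attribute [local instance] Matrix.linftyOpNormedRing Matrix.linftyOpNormedAlgebra in
/-- Collatz–Wielandt lower bound: a nonzero nonnegative vector with `μ x ≤ M x` bounds the spectral
radius from below. -/
theorem le_spectralRadius_of_le_mulVec {M : Matrix V V ℝ} (hM : ∀ i j, 0 ≤ M i j) {x : V → ℝ}
    (hx : ∀ i, 0 ≤ x i) {v : V} (hv : 0 < x v) {μ : ℝ} (hμ : 0 ≤ μ)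
    (h : ∀ i, μ * x i ≤ (M *ᵥ x) i) :
    ENNReal.ofReal μ ≤ spectralRadius ℂ (M.map Complex.ofReal) := by
  -- Iteration gives `M ^ k x ≥ μ ^ k x`. Read at the largest entry of `x`, this forces `‖M ^ k‖ ≥ μ
  -- ^ k` in the sup operator norm, and Gelfand's formula concludes.
  have hpow : ∀ (k : ℕ) (i : V), μ ^ k * x i ≤ ((M ^ k) *ᵥ x) i := by
    intro k
    induction k with
    | zero => intro i; simp
    | succ k ih =>
      intro i
      have h1 := mulVec_mono hM ih i
      have h2 : (M *ᵥ fun i => μ ^ k * x i) i = μ ^ k * (M *ᵥ x) i := by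
        simp only [Matrix.mulVec, dotProduct, Finset.mul_sum]
        exact Finset.sum_congr rfl fun j _ => by ring
      rw [pow_succ' M, ← Matrix.mulVec_mulVec]
      calc μ ^ (k + 1) * x i = μ ^ k * (μ * x i) := by ring
        _ ≤ μ ^ k * (M *ᵥ x) i := mul_le_mul_of_nonneg_left (h i) (pow_nonneg hμ k)
        _ ≤ _ := h2 ▸ h1
  obtain ⟨i, -, hi⟩ := Finset.exists_max_image Finset.univ x ⟨v, Finset.mem_univ _⟩
  have hxi : 0 < x i := hv.trans_le (hi v (Finset.mem_univ _))
  have hnorm : ∀ k : ℕ, μ ^ k ≤ ‖(M.map Complex.ofReal) ^ k‖ := by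
    intro k
    have hmap : (M.map Complex.ofReal) ^ k = (M ^ k).map Complex.ofReal :=
      (map_pow (Complex.ofRealHom.mapMatrix) M k).symm
    let y : V → ℂ := fun j => (x j : ℂ)
    have hy : ‖y‖ ≤ x i := (pi_norm_le_iff_of_nonneg hxi.le).2 fun j => by
      rw [Complex.norm_real, Real.norm_of_nonneg (hx j)]; exact hi j (Finset.mem_univ _)
    have hval : (((M ^ k).map Complex.ofReal) *ᵥ y) i = ((((M ^ k) *ᵥ x) i : ℝ) : ℂ) := by
      simp [Matrix.mulVec, dotProduct, y]
    have h1 : μ ^ k * x i ≤ ‖(M.map Complex.ofReal) ^ k‖ * x i := calc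
      μ ^ k * x i ≤ ((M ^ k) *ᵥ x) i := hpow k i
      _ ≤ ‖(((M ^ k).map Complex.ofReal) *ᵥ y) i‖ := by
        rw [hval, Complex.norm_real]; exact le_abs_self _
      _ ≤ ‖((M ^ k).map Complex.ofReal) *ᵥ y‖ := norm_le_pi_norm _ i
      _ ≤ ‖(M ^ k).map Complex.ofReal‖ * ‖y‖ := Matrix.linfty_opNorm_mulVec _ _
      _ ≤ ‖(M.map Complex.ofReal) ^ k‖ * x i := by
        rw [hmap]; exact mul_le_mul_of_nonneg_left hy (norm_nonneg _)
    exact le_of_mul_le_mul_right h1 hxi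
  refine ge_of_tendsto
    (spectrum.pow_nnnorm_pow_one_div_tendsto_nhds_spectralRadius (M.map Complex.ofReal)) ?_
  filter_upwards [Filter.eventually_ge_atTop 1] with k hk
  have hk0 : (0 : ℝ) < k := by exact_mod_cast hk
  rw [one_div, ENNReal.le_rpow_inv_iff hk0, ENNReal.rpow_natCast, ← ENNReal.ofReal_pow hμ,
    ← enorm_eq_nnnorm, ← ofReal_norm]
  exact ENNReal.ofReal_le_ofReal (hnorm k)

/-- Strict Collatz–Wielandt lower bound for an irreducible nonnegative matrix. -/
theorem lt_spectralRadius_of_le_mulVec {M : Matrix V V ℝ} (hM : ∀ i j, 0 ≤ M i j)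
    (hirr : ∀ i j, Relation.ReflTransGen (fun a b => 0 < M a b) i j) {x : V → ℝ}
    (hx : ∀ i, 0 < x i) {μ : ℝ} (hμ : 0 ≤ μ)
    (h : ∀ i, μ * x i ≤ (M *ᵥ x) i) {v : V} (hv : μ * x v < (M *ᵥ x) v) :
    ENNReal.ofReal μ < spectralRadius ℂ (M.map Complex.ofReal) := by
  -- A high power of `1 + M` commutes with `M` and spreads the strict inequality at `v` to every
  -- coordinate.
  set N : Matrix V V ℝ := 1 + M with hN
  have hN0 : ∀ (k : ℕ) (y : V → ℝ), (∀ i, 0 ≤ y i) → ∀ i, 0 ≤ ((N ^ k) *ᵥ y) i := by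
    intro k
    induction k with
    | zero => intro y hy i; simpa using hy i
    | succ k ih =>
      intro y hy i
      rw [pow_succ, ← Matrix.mulVec_mulVec]
      refine ih _ (fun j => ?_) i
      rw [hN, Matrix.add_mulVec, Matrix.one_mulVec]
      exact add_nonneg (hy j) (Finset.sum_nonneg fun l _ => mul_nonneg (hM j l) (hy l))
  have hstep : ∀ (k : ℕ) (y : V → ℝ) (i : V),
      ((N ^ (k + 1)) *ᵥ y) i = ((N ^ k) *ᵥ y) i + ∑ j, M i j * ((N ^ k) *ᵥ y) j := by
    intro k y i
    rw [pow_succ', ← Matrix.mulVec_mulVec]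
    conv_lhs => rw [hN, Matrix.add_mulVec, Matrix.one_mulVec]
    rfl
  set z : V → ℝ := fun i => (M *ᵥ x) i - μ * x i with hz
  have hz0 : ∀ i, 0 ≤ z i := fun i => sub_nonneg.2 (h i)
  -- Positivity is claimed for all large exponents so that a single `K` serves every vertex.
  have hpos : ∀ i, ∃ k, ∀ m, k ≤ m → 0 < ((N ^ m) *ᵥ z) i := by
    intro i
    induction hirr i v using Relation.ReflTransGen.head_induction_on with
    | refl =>
      refine ⟨0, fun m _ => ?_⟩
      induction m with
      | zero => simpa [z] using hv
      | succ m ih =>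
        rw [hstep]
        exact add_pos_of_pos_of_nonneg (ih (Nat.zero_le _))
          (Finset.sum_nonneg fun j _ => mul_nonneg (hM _ _) (hN0 m z hz0 j))
    | head hab _ ih =>
      obtain ⟨k, hk⟩ := ih
      refine ⟨k + 1, fun m hm => ?_⟩
      obtain ⟨m, rfl⟩ : ∃ m', m = m' + 1 := ⟨m - 1, by omega⟩
      rw [hstep]
      refine add_pos_of_nonneg_of_pos (hN0 m z hz0 _) ?_
      exact (mul_pos hab (hk m (by omega))).trans_le (Finset.single_le_sum
        (f := fun j => M _ j * ((N ^ m) *ᵥ z) j)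
        (fun j _ => mul_nonneg (hM _ _) (hN0 m z hz0 j)) (Finset.mem_univ _))
  choose k hk using hpos
  set K := Finset.univ.sup k
  set y := (N ^ K) *ᵥ x with hy
  have hy0 : ∀ i, 0 ≤ y i := hN0 K x fun i => (hx i).le
  have hcomm : M * N ^ K = N ^ K * M := by
    have : Commute M N := (Commute.one_right M).add_right (Commute.refl M)
    exact this.pow_right K
  have hMy : ∀ i, (M *ᵥ y) i - μ * y i = ((N ^ K) *ᵥ z) i := by
    intro i
    have : z = M *ᵥ x - μ • x := rfl
    rw [this, Matrix.mulVec_sub, Matrix.mulVec_smul, hy, Matrix.mulVec_mulVec x M, hcomm,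
      ← Matrix.mulVec_mulVec]
    rfl
  have hgt : ∀ i, μ * y i < (M *ᵥ y) i := fun i => by
    have := hk i K (Finset.le_sup (Finset.mem_univ i))
    rw [← hMy] at this
    linarith
  have hypos : 0 < y v := by
    have hge : ∀ m, 0 < ((N ^ m) *ᵥ x) v := by
      intro m
      induction m with
      | zero => simpa using hx v
      | succ m ih =>
        rw [hstep]
        exact add_pos_of_pos_of_nonneg ih (Finset.sum_nonneg fun j _ =>
          mul_nonneg (hM _ _) (hN0 m x (fun i => (hx i).le) j))
    exact hge K
  obtain ⟨ε, hε, hεy⟩ : ∃ ε > 0, ∀ i, (μ + ε) * y i ≤ (M *ᵥ y) i := by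
    -- Dividing by `y i + 1` avoids proving `y` positive everywhere: `(μ + ε) y ≤ μ y + ε (y + 1) ≤
    -- M y`.
    obtain ⟨i, -, hi⟩ := Finset.exists_min_image Finset.univ
      (fun i => ((M *ᵥ y) i - μ * y i) / (y i + 1)) ⟨v, Finset.mem_univ _⟩
    have hp : ∀ i, 0 < y i + 1 := fun i => by linarith [hy0 i]
    refine ⟨_, div_pos (sub_pos.2 (hgt i)) (hp i), fun j => ?_⟩
    have h1 := (le_div_iff₀ (hp j)).1 (hi j (Finset.mem_univ _))
    have h2 := (div_pos (sub_pos.2 (hgt i)) (hp i)).le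
    linarith [mul_add (((M *ᵥ y) i - μ * y i) / (y i + 1)) (y j) 1,
      add_mul μ (((M *ᵥ y) i - μ * y i) / (y i + 1)) (y j)]
  refine lt_of_lt_of_le ?_ (le_spectralRadius_of_le_mulVec hM hy0 hypos (by linarith) hεy)
  exact (ENNReal.ofReal_lt_ofReal_iff (by linarith)).2 (by linarith)

end Perron

/-! ### Test vectors from distances, and digraphs determined by labels -/

section Levels

variable {V : Type*} [Fintype V]

open Classical in
theorem alphaMatrix_mulVec [DecidableEq V] (α : ℝ) (G : Digraph V) (x : V → ℝ) (v : V) :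
    (alphaMatrix α G *ᵥ x) v =
      α * outdegree G v * x v + (1 - α) * ∑ w with G.Adj v w, x w := by
  rw [alphaMatrix, Matrix.add_mulVec, Matrix.smul_mulVec, Matrix.smul_mulVec, Pi.add_apply,
    Pi.smul_apply, Pi.smul_apply, Matrix.mulVec_diagonal, Finset.sum_filter]
  simp [adjMatrix, Matrix.mulVec, dotProduct, mul_assoc]

theorem alphaMatrix_nonneg [DecidableEq V] {α : ℝ} (hα0 : 0 ≤ α) (hα1 : α < 1) (G : Digraph V)
    (v w : V) : 0 ≤ alphaMatrix α G v w := by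
  have h1 : 0 ≤ adjMatrix G v w := by
    simp only [adjMatrix, Matrix.of_apply]; split_ifs <;> norm_num
  have h2 : 0 ≤ Matrix.diagonal (fun v => (outdegree G v : ℝ)) v w := by
    rw [Matrix.diagonal_apply]; split_ifs <;> simp
  exact add_nonneg (mul_nonneg hα0 h2) (mul_nonneg (by linarith) h1)

theorem alphaMatrix_pos_of_adj [DecidableEq V] {α : ℝ} (hα0 : 0 ≤ α) (hα1 : α < 1) {G : Digraph V}
    {v w : V} (h : G.Adj v w) : 0 < alphaMatrix α G v w := by
  have h1 : adjMatrix G v w = 1 := by simp [adjMatrix, h]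
  have h2 : 0 ≤ Matrix.diagonal (fun v => (outdegree G v : ℝ)) v w := by
    rw [Matrix.diagonal_apply]; split_ifs <;> simp
  have h3 : alphaMatrix α G v w =
    α * Matrix.diagonal (fun v => (outdegree G v : ℝ)) v w + (1 - α) * adjMatrix G v w := rfl
  rw [h3, h1]
  nlinarith [mul_nonneg hα0 h2]

theorem outdegree_pos {G : Digraph V} {v w : V} (h : G.Adj v w) : 1 ≤ outdegree G v := by
  classical
  exact Finset.card_pos.2 ⟨w, by simp [h]⟩

-- Off level 0, one out-neighbour a level lower already pays for `lam * t ^ d v`, by the relation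
-- between `lam` and `t`; further arcs only help. At level 0 the test vector is 1 and the hypothesis
-- on `E` is exactly what is needed.
open Classical in
theorem level_inequality {G : Digraph V} {α t lam E : ℝ} (hα0 : 0 ≤ α)
    (hα1 : α < 1) (ht0 : 0 < t) (hlam : lam * t = α * t + (1 - α))
    (hE : lam = 2 * α + (1 - α) * E) {d : V → ℕ}
    (h1 : ∀ v, d v ≠ 0 → ∃ w, G.Adj v w ∧ d w + 1 = d v)
    (h2 : ∀ v, d v = 0 → 2 ≤ outdegree G v ∧ E ≤ ∑ w with G.Adj v w, t ^ d w) (v : V) :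
    lam * t ^ d v ≤ α * outdegree G v * t ^ d v + (1 - α) * ∑ w with G.Adj v w, t ^ d w := by
  by_cases hv : d v = 0
  · obtain ⟨hdeg, hsum⟩ := h2 v hv
    have hdeg' : (2 : ℝ) ≤ outdegree G v := by exact_mod_cast hdeg
    have := mul_le_mul_of_nonneg_left hsum (by linarith : 0 ≤ 1 - α)
    have := mul_le_mul_of_nonneg_left hdeg' hα0
    rw [hv, pow_zero]
    linarith
  · obtain ⟨w, hw, hdw⟩ := h1 v hv
    have hdeg : (1 : ℝ) ≤ outdegree G v := by exact_mod_cast outdegree_pos hw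
    have hsum : t ^ d w ≤ ∑ w with G.Adj v w, t ^ d w :=
      Finset.single_le_sum (f := fun w => t ^ d w) (fun _ _ => (pow_pos ht0 _).le) (by simp [hw])
    have h3 := mul_le_mul_of_nonneg_left hsum (by linarith : 0 ≤ 1 - α)
    have h4 := mul_le_mul_of_nonneg_right (mul_le_mul_of_nonneg_left hdeg hα0)
      (pow_pos ht0 (d v)).le
    have h5 : lam * t ^ d v = α * t ^ d v + (1 - α) * t ^ d w := by
      rw [← hdw, pow_succ', ← mul_assoc, hlam]; ring
    linarith

open Classical in
/-- Lower bound for the `α`-spectral radius from the test vector `v ↦ t ^ d v`. -/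
theorem le_alphaSpectralRadius [DecidableEq V] {G : Digraph V} {α t lam E : ℝ}
    (hα0 : 0 ≤ α) (hα1 : α < 1) (ht0 : 0 < t) (hlam : lam * t = α * t + (1 - α))
    (hE : lam = 2 * α + (1 - α) * E) {d : V → ℕ}
    (h1 : ∀ v, d v ≠ 0 → ∃ w, G.Adj v w ∧ d w + 1 = d v)
    (h2 : ∀ v, d v = 0 → 2 ≤ outdegree G v ∧ E ≤ ∑ w with G.Adj v w, t ^ d w)
    (v : V) : ENNReal.ofReal lam ≤ alphaSpectralRadius α G := by
  have hlam0 : 0 ≤ lam := by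
    by_contra hneg
    nlinarith [mul_pos_of_neg_of_neg (not_le.1 hneg) (neg_lt_zero.2 ht0), mul_nonneg hα0 ht0.le]
  refine le_spectralRadius_of_le_mulVec (alphaMatrix_nonneg hα0 hα1 G) (x := fun v => t ^ d v)
    (fun _ => (pow_pos ht0 _).le) (v := v) (pow_pos ht0 _) hlam0 fun v => ?_
  rw [alphaMatrix_mulVec]
  exact level_inequality hα0 hα1 ht0 hlam hE h1 h2 v

open Classical in
theorem lt_alphaSpectralRadius [DecidableEq V] {G : Digraph V}
    (hG : ∀ u v, Relation.ReflTransGen G.Adj u v) {α t lam E : ℝ} (hα0 : 0 ≤ α)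
    (hα1 : α < 1) (ht0 : 0 < t) (hlam : lam * t = α * t + (1 - α))
    (hE : lam = 2 * α + (1 - α) * E) {d : V → ℕ}
    (h1 : ∀ v, d v ≠ 0 → ∃ w, G.Adj v w ∧ d w + 1 = d v)
    (h2 : ∀ v, d v = 0 → 2 ≤ outdegree G v ∧ E ≤ ∑ w with G.Adj v w, t ^ d w)
    {v : V} (hv : d v = 0) (hlt : E < ∑ w with G.Adj v w, t ^ d w) :
    ENNReal.ofReal lam < alphaSpectralRadius α G := by
  have hlam0 : 0 ≤ lam := by
    by_contra hneg
    nlinarith [mul_pos_of_neg_of_neg (not_le.1 hneg) (neg_lt_zero.2 ht0), mul_nonneg hα0 ht0.le]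
  refine lt_spectralRadius_of_le_mulVec (alphaMatrix_nonneg hα0 hα1 G)
    (fun i j => Relation.ReflTransGen.mono
      (fun _ _ hab => alphaMatrix_pos_of_adj hα0 hα1 hab) i j (hG i j))
    (x := fun v => t ^ d v)
    (fun _ => pow_pos ht0 _) hlam0 (fun v => ?_) (v := v) ?_
  · rw [alphaMatrix_mulVec]
    exact level_inequality hα0 hα1 ht0 hlam hE h1 h2 v
  · rw [alphaMatrix_mulVec]
    have hdeg' : (2 : ℝ) ≤ outdegree G v := by exact_mod_cast (h2 v hv).1
    have := mul_lt_mul_of_pos_left hlt (by linarith : 0 < 1 - α)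
    have := mul_le_mul_of_nonneg_left hdeg' hα0
    simp only [hv, pow_zero]
    linarith

open Classical in
theorem sum_out_eq_of_unique {G : Digraph V} {v w : V} (h : ∀ z, G.Adj v z ↔ z = w) (x : V → ℝ) :
    outdegree G v = 1 ∧ ∑ z with G.Adj v z, x z = x w := by
  have : (Finset.univ.filter fun z => G.Adj v z) = {w} := by ext z; simp [h]
  simp [outdegree, this]

open Classical in
theorem sum_out_eq_of_pair {G : Digraph V} {v w₁ w₂ : V} (hne : w₁ ≠ w₂)
    (h : ∀ z, G.Adj v z ↔ z = w₁ ∨ z = w₂) (x : V → ℝ) :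
    outdegree G v = 2 ∧ ∑ z with G.Adj v z, x z = x w₁ + x w₂ := by
  have : (Finset.univ.filter fun z => G.Adj v z) = {w₁, w₂} := by ext z; simp [h]
  simp [outdegree, this, hne]

/-- Upper bound for the `α`-spectral radius from the eigenvector `v ↦ t ^ d v`. -/
theorem alphaSpectralRadius_le [DecidableEq V] {G : Digraph V} {α t lam E : ℝ}
    (hα0 : 0 ≤ α) (hα1 : α < 1) (ht0 : 0 < t) (hlam : lam * t = α * t + (1 - α))
    (hE : lam = 2 * α + (1 - α) * E) {d : V → ℕ}
    (h1 : ∀ v, d v ≠ 0 → ∃ w, (∀ z, G.Adj v z ↔ z = w) ∧ d w + 1 = d v)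
    (h2 : ∀ v, d v = 0 → ∃ w₁ w₂, w₁ ≠ w₂ ∧ (∀ z, G.Adj v z ↔ z = w₁ ∨ z = w₂) ∧
      t ^ d w₁ + t ^ d w₂ = E) :
    alphaSpectralRadius α G ≤ ENNReal.ofReal lam := by
  refine spectralRadius_le_of_mulVec_le (alphaMatrix_nonneg hα0 hα1 G) (x := fun v => t ^ d v)
    (fun _ => pow_pos ht0 _) fun v => ?_
  rw [alphaMatrix_mulVec]
  by_cases hv : d v = 0
  · obtain ⟨w₁, w₂, hne, hadj, hsum⟩ := h2 v hv
    obtain ⟨e1, e2⟩ := sum_out_eq_of_pair hne hadj fun v => t ^ d v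
    rw [e1, e2, hv, hsum, hE]
    push_cast
    linarith
  · obtain ⟨w, hadj, hdw⟩ := h1 v hv
    obtain ⟨e1, e2⟩ := sum_out_eq_of_unique hadj fun v => t ^ d v
    rw [e1, e2, ← hdw, pow_succ', ← mul_assoc lam, hlam]
    push_cast
    linarith

/-- The Perron parameter `t` of a digraph whose only branching vertex lies on cycles of lengths
`e₁ + 1` and `e₂ + 1`. -/
theorem exists_perron_parameter {α : ℝ} (hα1 : α < 1) (e₁ e₂ : ℕ) :
    ∃ t lam : ℝ, 0 < t ∧ t < 1 ∧ lam * t = α * t + (1 - α) ∧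
      lam = 2 * α + (1 - α) * (t ^ e₁ + t ^ e₂) := by
  -- Eliminating `lam` from the two required equations leaves `f t = 0`; `f` falls from `1 - α > 0`
  -- at 0 to `-1` at 1.
  let f : ℝ → ℝ := fun t => (1 - α) * (1 - t ^ (e₁ + 1) - t ^ (e₂ + 1)) - α * t
  have hf : ContinuousOn f (Set.Icc 0 1) := by fun_prop
  have hmem : (0 : ℝ) ∈ Set.Icc (f 1) (f 0) := by
    constructor
    · simp [f]
    · simp [f, hα1.le]
  obtain ⟨t, ht, hft⟩ := intermediate_value_Icc' zero_le_one hf hmem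
  have h0 : t ≠ 0 := by
    rintro rfl
    simp only [f, mul_zero, sub_zero, ne_eq, Nat.add_eq_zero_iff, one_ne_zero, and_false,
      not_false_eq_true, zero_pow, mul_one] at hft
    linarith
  have h1 : t ≠ 1 := by
    rintro rfl
    simp only [f, one_pow, sub_self, zero_sub, mul_one] at hft
    linarith
  have ht0 : 0 < t := lt_of_le_of_ne ht.1 (Ne.symm h0)
  have ht1 : t < 1 := lt_of_le_of_ne ht.2 h1
  refine ⟨t, 2 * α + (1 - α) * (t ^ e₁ + t ^ e₂), ht0, ht1, ?_, rfl⟩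
  simp only [f] at hft
  rw [pow_succ, pow_succ] at hft
  linarith

/-- A distance function to a set that every vertex can reach. -/
theorem exists_level {V : Type*} (r : V → V → Prop) (S : V → Prop)
    (h : ∀ v, ∃ s, S s ∧ Relation.ReflTransGen r v s) :
    ∃ d : V → ℕ, (∀ v, d v = 0 ↔ S v) ∧ ∀ v, d v ≠ 0 → ∃ w, r v w ∧ d w + 1 = d v := by
  classical
  -- `P k v`: some walk of length exactly `k` leads from `v` into `S`.
  let P : ℕ → V → Prop := fun k =>
    Nat.rec (motive := fun _ => V → Prop) S (fun _ Q v => ∃ w, r v w ∧ Q w) k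
  have hP : ∀ v, ∃ k, P k v := by
    intro v
    obtain ⟨s, hs, hvs⟩ := h v
    induction hvs using Relation.ReflTransGen.head_induction_on with
    | refl => exact ⟨0, hs⟩
    | head hab _ ih => exact ih.elim fun k hk => ⟨k + 1, _, hab, hk⟩
  have (v : V) : DecidablePred fun k => P k v := Classical.decPred _
  refine ⟨fun v => Nat.find (hP v), fun v => Nat.find_eq_zero (hP v), fun v hv => ?_⟩
  obtain ⟨k, hk⟩ := Nat.exists_eq_succ_of_ne_zero hv
  have hspec := Nat.find_spec (hP v)
  simp only at hk
  rw [hk] at hspec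
  obtain ⟨w, hvw, hw⟩ := hspec
  have h1 : Nat.find (hP w) ≤ k := Nat.find_min' _ hw
  have h2 : Nat.find (hP v) ≤ Nat.find (hP w) + 1 :=
    Nat.find_min' (hP v) ⟨w, hvw, Nat.find_spec (hP w)⟩
  exact ⟨w, hvw, by
    change Nat.find (hP w) + 1 = Nat.find (hP v); omega⟩

/-- The level can be lowered one unit at a time, so none is skipped on the way down. -/
theorem exists_level_eq {V : Type*} {d : V → ℕ} (h : ∀ v, d v ≠ 0 → ∃ w, d w + 1 = d v) :
    ∀ (v : V) (m : ℕ), m ≤ d v → ∃ w, d w = m := by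
  intro v m hm
  induction hk : d v - m generalizing v with
  | zero => exact ⟨v, by omega⟩
  | succ k ih =>
    obtain ⟨w, hw⟩ := h v (by omega)
    exact ih w (by omega) (by omega)

theorem le_card_of_levels {V : Type*} {d : V → ℕ} {M : ℕ} {X : Finset V}
    (h : ∀ m < M, ∃ x ∈ X, d x = m) : M ≤ X.card := by
  classical
  have : Finset.range M ⊆ X.image d := fun m hm => by
    obtain ⟨x, hx, hxm⟩ := h m (Finset.mem_range.1 hm)
    exact Finset.mem_image.2 ⟨x, hx, hxm⟩
  simpa using (Finset.card_le_card this).trans Finset.card_image_le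

theorem injective_of_levels {c : V → ℕ} {n : ℕ} (hcard : Fintype.card V = n)
    (h : ∀ m < n, ∃ v, c v = m) : Function.Injective c ∧ ∀ v, c v < n := by
  choose g hg using fun m : Fin n => h m m.2
  have hinj : Function.Injective g := fun a b hab => Fin.ext (by rw [← hg a, ← hg b, hab])
  have hbij : Function.Bijective g :=
    (Fintype.bijective_iff_injective_and_card g).2 ⟨hinj, by simp [hcard]⟩
  constructor
  · intro a b hab
    obtain ⟨i, rfl⟩ := hbij.2 a
    obtain ⟨j, rfl⟩ := hbij.2 b
    rw [hg, hg] at hab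
    rw [Fin.ext hab]
  · intro v
    obtain ⟨i, rfl⟩ := hbij.2 v
    rw [hg]; exact i.2

/-- Reduces isomorphism to arithmetic: bijective labellings under which both adjacencies become the
same relation `R` compose to an isomorphism. -/
theorem isomorphic_of_labels {W : Type*} [Fintype W] {n : ℕ} {G : Digraph V} {H : Digraph W}
    (hV : Fintype.card V = n) (hW : Fintype.card W = n) {c : V → ℕ} {e : W → ℕ}
    (hc : ∀ m < n, ∃ v, c v = m) (he : ∀ m < n, ∃ v, e v = m) (R : ℕ → ℕ → Prop)
    (hG : ∀ v w, G.Adj v w ↔ R (c v) (c w)) (hH : ∀ v w, H.Adj v w ↔ R (e v) (e w)) :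
    Isomorphic G H := by
  obtain ⟨ci, cn⟩ := injective_of_levels hV hc
  obtain ⟨ei, en⟩ := injective_of_levels hW he
  let f : V → Fin n := fun v => ⟨c v, cn v⟩
  let g : W → Fin n := fun v => ⟨e v, en v⟩
  have hf : Function.Bijective f := (Fintype.bijective_iff_injective_and_card f).2
    ⟨fun a b hab => ci (congrArg Fin.val hab), by simp [hV]⟩
  have hg : Function.Bijective g := (Fintype.bijective_iff_injective_and_card g).2
    ⟨fun a b hab => ei (congrArg Fin.val hab), by simp [hW]⟩
  let φ : V ≃ W := (Equiv.ofBijective f hf).trans (Equiv.ofBijective g hg).symm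
  have hφ : ∀ v, e (φ v) = c v := fun v =>
    congrArg Fin.val ((Equiv.ofBijective g hg).apply_symm_apply (f v))
  exact ⟨⟨φ, fun {a b} => by rw [hH, hG, hφ, hφ]⟩⟩

end Levels

/-! ### Theta digraphs in terms of labels -/

/-- The arcs of `Θ̃(a, b; l)` in terms of the labels of the vertices: the path of length `l` carries
the labels `l, …, 0`, the interior of the path of length `b` the labels `l + b - 1, …, l + 1`, and
the interior of the path of length `a` the labels `l + b + a - 2, …, l + b`. -/
def thetaRel (a b l i j : ℕ) : Prop :=
  (i = 0 ∧ (j + 2 = l + a + b ∨ j + 1 = l + b)) ∨ (i ≠ 0 ∧ i ≠ l + b ∧ j + 1 = i) ∨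
    (i = l + b ∧ j = l)

section Labels

variable {V : Type*} [Fintype V] {n a b l : ℕ} {G : Digraph V} {c : V → ℕ}

/-- Every arc not leaving label 0 lowers the label, so all vertices reach 0. Conversely 0 jumps to
the top label and walks down; only label `l + b - 1` is not entered from its successor, and it is
entered from 0 directly. -/
theorem isStrongOfOrder_of_labels (hcard : Fintype.card V = n) (hn : l + a + b = n + 1)
    (ha : 2 ≤ a) (hb : 1 ≤ b) (hl : 1 ≤ l) (hc : ∀ m < n, ∃ v, c v = m)
    (hadj : ∀ v w, G.Adj v w ↔ thetaRel a b l (c v) (c w)) : IsStrongOfOrder n G := by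
  obtain ⟨hinj, hlt⟩ := injective_of_levels hcard hc
  obtain ⟨u, hu⟩ := hc 0 (by omega)
  have hto : ∀ m v, c v = m → Relation.ReflTransGen G.Adj v u := by
    intro m
    induction m using Nat.strong_induction_on with
    | _ m ih =>
      intro v hv
      by_cases h0 : m = 0
      · rw [hinj (hv.trans (h0.trans hu.symm))]
      · have hvn := hlt v
        by_cases h1 : m = l + b
        · obtain ⟨w, hw⟩ := hc l (by omega)
          exact .head ((hadj v w).2 (by unfold thetaRel; omega)) (ih l (by omega) w hw)
        · obtain ⟨w, hw⟩ := hc (m - 1) (by omega)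
          exact .head ((hadj v w).2 (by unfold thetaRel; omega)) (ih (m - 1) (by omega) w hw)
  have hfrom : ∀ m v, c v + m + 1 = n → Relation.ReflTransGen G.Adj u v := by
    intro m
    induction m with
    | zero => exact fun v hv => .single ((hadj u v).2 (by unfold thetaRel; omega))
    | succ m ih =>
      intro v hv
      by_cases h1 : c v + 1 = l + b
      · exact .single ((hadj u v).2 (by unfold thetaRel; omega))
      · obtain ⟨w, hw⟩ := hc (c v + 1) (by omega)
        exact .tail (ih w (by omega)) ((hadj w v).2 (by unfold thetaRel; omega))
  refine ⟨hcard, fun v hv => ?_, fun v w => (hto _ v rfl).trans (hfrom (n - 1 - c w) w ?_)⟩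
  · have := (hadj v v).1 hv
    unfold thetaRel at this
    omega
  · have := hlt w
    omega

theorem exists_levels_of_labels (hcard : Fintype.card V = n) (hn : l + a + b = n + 1)
    (ha : 2 ≤ a) (hb : 1 ≤ b) (hl : 1 ≤ l) (hc : ∀ m < n, ∃ v, c v = m)
    (hadj : ∀ v w, G.Adj v w ↔ thetaRel a b l (c v) (c w)) :
    ∃ d : V → ℕ, (∀ v, d v ≠ 0 → ∃ w, (∀ z, G.Adj v z ↔ z = w) ∧ d w + 1 = d v) ∧
      (∀ v, d v = 0 → ∃ w₁ w₂, w₁ ≠ w₂ ∧ (∀ z, G.Adj v z ↔ z = w₁ ∨ z = w₂) ∧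
        d w₁ = l + a - 1 ∧ d w₂ = l + b - 1) ∧ ∃ u, d u = 0 := by
  obtain ⟨hinj, hlt⟩ := injective_of_levels hcard hc
  -- This is the distance to `u`: labels on the interior of the path of length `a` skip the `b - 1`
  -- labels of the other interior.
  refine ⟨fun v => if l + b ≤ c v then c v + 1 - b else c v, fun v hv => ?_, fun v hv => ?_, ?_⟩
  · have hvn := hlt v
    have h0 : c v ≠ 0 := by intro h; simp only [h] at hv; split_ifs at hv <;> omega
    by_cases h1 : c v = l + b
    · obtain ⟨w, hw⟩ := hc l (by omega)
      refine ⟨w, fun z => ?_, by simp only [hw]; split_ifs <;> omega⟩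
      rw [hadj, ← hinj.eq_iff, hw]
      unfold thetaRel; omega
    · obtain ⟨w, hw⟩ := hc (c v - 1) (by omega)
      refine ⟨w, fun z => ?_, by simp only [hw]; split_ifs <;> omega⟩
      rw [hadj, ← hinj.eq_iff, hw]
      unfold thetaRel; omega
  · have h0 : c v = 0 := by
      by_contra h
      simp only at hv
      split_ifs at hv <;> omega
    obtain ⟨w₁, hw₁⟩ := hc (n - 1) (by omega)
    obtain ⟨w₂, hw₂⟩ := hc (l + b - 1) (by omega)
    refine ⟨w₁, w₂, fun h => ?_, fun z => ?_, ?_, ?_⟩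
    · rw [h] at hw₁; omega
    · rw [hadj, ← hinj.eq_iff, ← hinj.eq_iff, hw₁, hw₂]
      unfold thetaRel; omega
    · simp only [hw₁]; split_ifs <;> omega
    · simp only [hw₂]; split_ifs <;> omega
  · obtain ⟨u, hu⟩ := hc 0 (by omega)
    exact ⟨u, by simp only [hu]; split_ifs <;> omega⟩

end Labels

/-! ### The labelling of `Θ̃(k₀, k₁; l₀)` and bounds for its radius -/

section Theta

variable (k : Fin 2 → ℕ) (l : Fin 1 → ℕ)

/-- The labelling of the vertices of `Θ̃(k₀, k₁; l₀)` by `0, …, k₀ + k₁ + l₀ - 2`. -/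
def thetaLabel : ThetaVertex k l → ℕ
  | Sum.inl false => 0
  | Sum.inl true => l 0
  | Sum.inr (Sum.inl ⟨i, q⟩) =>
      if i = 0 then l 0 + (k 1 - 1) + (k 0 - 1 - q) else l 0 + (k 1 - 1 - q)
  | Sum.inr (Sum.inr ⟨_, q⟩) => l 0 - 1 - q

theorem thetaLabel_forward_zero (p : ℕ) : thetaLabel k l (forwardVertex k l 0 p) =
    if p = 0 then 0 else if p < k 0 then l 0 + (k 1 - 1) + (k 0 - p) else l 0 := by
  unfold forwardVertex
  split_ifs <;> simp [thetaLabel] <;> omega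

theorem thetaLabel_forward_one (p : ℕ) : thetaLabel k l (forwardVertex k l 1 p) =
    if p = 0 then 0 else l 0 + (k 1 - p) := by
  unfold forwardVertex
  split_ifs <;> simp [thetaLabel] <;> omega

theorem thetaLabel_backward (j : Fin 1) (p : ℕ) :
    thetaLabel k l (backwardVertex k l j p) = l 0 - p := by
  obtain rfl : j = 0 := Subsingleton.elim _ _
  unfold backwardVertex
  split_ifs <;> simp [thetaLabel] <;> omega

theorem card_thetaVertex : Fintype.card (ThetaVertex k l) =
    2 + ((k 0 - 1) + (k 1 - 1)) + (l 0 - 1) := by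
  simp [ThetaVertex, Fintype.card_sum, Fintype.card_sigma]
  omega

variable {k l} {n : ℕ}

theorem exists_thetaLabel_eq (hn : l 0 + k 0 + k 1 = n + 1) (hk₀ : 2 ≤ k 0) (hk₁ : 1 ≤ k 1)
    (m : ℕ) (hm : m < n) : ∃ v, thetaLabel k l v = m := by
  by_cases h1 : m ≤ l 0
  · exact ⟨backwardVertex k l 0 (l 0 - m), by rw [thetaLabel_backward]; omega⟩
  · by_cases h2 : m < l 0 + k 1
    · exact ⟨forwardVertex k l 1 (l 0 + k 1 - m), by
        rw [thetaLabel_forward_one]; split_ifs <;> omega⟩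
    · exact ⟨forwardVertex k l 0 (l 0 + (k 1 - 1) + k 0 - m), by
        rw [thetaLabel_forward_zero]; split_ifs <;> omega⟩

theorem theta_adj_iff (hn : l 0 + k 0 + k 1 = n + 1) (hk₀ : 2 ≤ k 0) (hk₁ : 1 ≤ k 1)
    (hl : 1 ≤ l 0) (x y : ThetaVertex k l) : (theta k l).Adj x y ↔
      thetaRel (k 0) (k 1) (l 0) (thetaLabel k l x) (thetaLabel k l y) := by
  have hcard : Fintype.card (ThetaVertex k l) = n := by rw [card_thetaVertex]; omega
  obtain ⟨hinj, hlt⟩ := injective_of_levels hcard (exists_thetaLabel_eq hn hk₀ hk₁)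
  constructor
  · rintro (⟨i, p, hp, rfl, rfl⟩ | ⟨j, p, hp, rfl, rfl⟩)
    · unfold thetaRel
      obtain rfl | rfl : i = 0 ∨ i = 1 := by fin_cases i <;> simp
      · simp only [thetaLabel_forward_zero, Nat.add_one_ne_zero, if_false]
        split_ifs <;> omega
      · simp only [thetaLabel_forward_one, Nat.add_one_ne_zero, if_false]
        split_ifs <;> omega
    · obtain rfl : j = 0 := Subsingleton.elim _ _
      rw [thetaLabel_backward, thetaLabel_backward]
      unfold thetaRel
      omega
  · intro h
    have hx := hlt x
    have hy := hlt y
    have h₀ (p : ℕ) (hp : p < k 0)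
        (hpx : thetaLabel k l (forwardVertex k l 0 p) = thetaLabel k l x)
        (hpy : thetaLabel k l (forwardVertex k l 0 (p + 1)) = thetaLabel k l y) :
        (theta k l).Adj x y := .inl ⟨0, p, hp, (hinj hpx).symm, (hinj hpy).symm⟩
    have h₁ (p : ℕ) (hp : p < k 1)
        (hpx : thetaLabel k l (forwardVertex k l 1 p) = thetaLabel k l x)
        (hpy : thetaLabel k l (forwardVertex k l 1 (p + 1)) = thetaLabel k l y) :
        (theta k l).Adj x y := .inl ⟨1, p, hp, (hinj hpx).symm, (hinj hpy).symm⟩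
    have h₂ (p : ℕ) (hp : p < l 0)
        (hpx : thetaLabel k l (backwardVertex k l 0 p) = thetaLabel k l x)
        (hpy : thetaLabel k l (backwardVertex k l 0 (p + 1)) = thetaLabel k l y) :
        (theta k l).Adj x y := .inr ⟨0, p, hp, (hinj hpx).symm, (hinj hpy).symm⟩
    simp only [thetaLabel_forward_zero, thetaLabel_forward_one, thetaLabel_backward,
      Nat.add_one_ne_zero, if_false] at h₀ h₁ h₂
    -- The position `p` on the path is read off from the label of `x`.
    rcases h with ⟨hx0, hy' | hy'⟩ | ⟨hx0, hx1, hxy⟩ | ⟨hx1, hyl⟩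
    · apply h₀ 0 <;> (try split_ifs) <;> omega
    · apply h₁ 0 <;> (try split_ifs) <;> omega
    · by_cases c1 : thetaLabel k l x ≤ l 0
      · apply h₂ (l 0 - thetaLabel k l x) <;> omega
      · by_cases c2 : thetaLabel k l x < l 0 + k 1
        · apply h₁ (l 0 + k 1 - thetaLabel k l x) <;> (try split_ifs) <;> omega
        · apply h₀ (l 0 + (k 1 - 1) + k 0 - thetaLabel k l x) <;> (try split_ifs) <;> omega
    · apply h₀ (k 0 - 1) <;> (try split_ifs) <;> omega

theorem theta_isStrongOfOrder (hn : l 0 + k 0 + k 1 = n + 1) (hk₀ : 2 ≤ k 0) (hk₁ : 1 ≤ k 1)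
    (hl : 1 ≤ l 0) : IsStrongOfOrder n (theta k l) :=
  isStrongOfOrder_of_labels (by rw [card_thetaVertex]; omega) hn hk₀ hk₁ hl
    (exists_thetaLabel_eq hn hk₀ hk₁) (theta_adj_iff hn hk₀ hk₁ hl)

theorem isomorphic_theta {V : Type*} [Fintype V] {G : Digraph V} {c : V → ℕ}
    (hn : l 0 + k 0 + k 1 = n + 1) (hk₀ : 2 ≤ k 0) (hk₁ : 1 ≤ k 1) (hl : 1 ≤ l 0)
    (hcard : Fintype.card V = n) (hc : ∀ m < n, ∃ v, c v = m)
    (hadj : ∀ v w, G.Adj v w ↔ thetaRel (k 0) (k 1) (l 0) (c v) (c w)) :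
    Isomorphic G (theta k l) :=
  isomorphic_of_labels hcard (by rw [card_thetaVertex]; omega) hc
    (exists_thetaLabel_eq hn hk₀ hk₁) _ hadj (theta_adj_iff hn hk₀ hk₁ hl)

theorem theta_alphaSpectralRadius_le (hn : l 0 + k 0 + k 1 = n + 1) (hk₀ : 2 ≤ k 0)
    (hk₁ : 1 ≤ k 1) (hl : 1 ≤ l 0) {α t lam : ℝ} (hα0 : 0 ≤ α) (hα1 : α < 1) (ht0 : 0 < t)
    (hlam : lam * t = α * t + (1 - α))
    {e₁ e₂ : ℕ} (h₁ : e₁ + 1 = l 0 + k 0) (h₂ : e₂ + 1 = l 0 + k 1)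
    (hE : lam = 2 * α + (1 - α) * (t ^ e₁ + t ^ e₂)) :
    alphaSpectralRadius α (theta k l) ≤ ENNReal.ofReal lam := by
  obtain ⟨d, h1, h2, -⟩ := exists_levels_of_labels (by rw [card_thetaVertex]; omega) hn hk₀ hk₁ hl
    (exists_thetaLabel_eq hn hk₀ hk₁) (theta_adj_iff hn hk₀ hk₁ hl)
  refine alphaSpectralRadius_le hα0 hα1 ht0 hlam hE h1 fun v hv => ?_
  obtain ⟨w₁, w₂, hne, hadj, e₁, e₂⟩ := h2 v hv
  exact ⟨w₁, w₂, hne, hadj, by rw [e₁, e₂, ← h₁, ← h₂]; rfl⟩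

/-- Meant for a `t` coming from a different digraph: a smaller sum `E` at the same `t` means a
smaller radius. -/
theorem lt_theta_alphaSpectralRadius (hn : l 0 + k 0 + k 1 = n + 1) (hk₀ : 2 ≤ k 0)
    (hk₁ : 1 ≤ k 1) (hl : 1 ≤ l 0) {α t lam E : ℝ} (hα0 : 0 ≤ α) (hα1 : α < 1) (ht0 : 0 < t)
    (hlam : lam * t = α * t + (1 - α)) (hE : lam = 2 * α + (1 - α) * E)
    {e₁ e₂ : ℕ} (h₁ : e₁ + 1 = l 0 + k 0) (h₂ : e₂ + 1 = l 0 + k 1)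
    (hlt : E < t ^ e₁ + t ^ e₂) :
    ENNReal.ofReal lam < alphaSpectralRadius α (theta k l) := by
  obtain ⟨d, h1, h2, u, hu⟩ := exists_levels_of_labels (by rw [card_thetaVertex]; omega) hn hk₀ hk₁
    hl (exists_thetaLabel_eq hn hk₀ hk₁) (theta_adj_iff hn hk₀ hk₁ hl)
  classical
  have h3 (v) (hv : d v = 0) : outdegree (theta k l) v = 2 ∧
      ∑ z with (theta k l).Adj v z, t ^ d z = t ^ e₁ + t ^ e₂ := by
    obtain ⟨w₁, w₂, hne, hadj, hd₁, hd₂⟩ := h2 v hv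
    have := sum_out_eq_of_pair hne hadj fun v => t ^ d v
    rw [hd₁, hd₂, ← h₁, ← h₂] at this
    exact this
  refine lt_alphaSpectralRadius (theta_isStrongOfOrder hn hk₀ hk₁ hl).2.2 hα0 hα1 ht0 hlam hE
    (d := d) (fun v hv => ?_) (fun v hv => ⟨(h3 v hv).1.ge, ?_⟩) hu ?_
  · obtain ⟨w, hw, hd⟩ := h1 v hv
    exact ⟨w, (hw w).2 rfl, hd⟩
  · exact hlt.le.trans_eq (h3 v hv).2.symm
  · exact hlt.trans_eq (h3 u hu).2.symm

end Theta

/-! ### The directed cycle -/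

/-- The arcs of the directed cycle on `n` vertices labelled `n - 1, …, 0` along the cycle. -/
def dicycleRel (n i j : ℕ) : Prop :=
  (i ≠ 0 ∧ j + 1 = i) ∨ (i = 0 ∧ j + 1 = n)

section Dicycle

/-- The distance from a vertex of the directed cycle to the vertex `0`. -/
def dicycleLabel (n : ℕ) (i : Fin n) : ℕ := if (i : ℕ) = 0 then 0 else n - i

theorem exists_dicycleLabel_eq (n m : ℕ) (hm : m < n) : ∃ v, dicycleLabel n v = m := by
  by_cases h : m = 0
  · exact ⟨⟨0, by omega⟩, by simp [dicycleLabel, h]⟩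
  · refine ⟨⟨n - m, by omega⟩, ?_⟩
    unfold dicycleLabel
    simp only
    split_ifs <;> omega

theorem dicycle_adj_iff (n : ℕ) (x y : Fin n) :
    (dicycle n).Adj x y ↔ dicycleRel n (dicycleLabel n x) (dicycleLabel n y) := by
  have hx := x.2
  have hy := y.2
  change (y : ℕ) = (x + 1) % n ↔ _
  unfold dicycleRel dicycleLabel
  by_cases h : (x : ℕ) + 1 = n
  · rw [h, Nat.mod_self]
    split_ifs <;> omega
  · rw [Nat.mod_eq_of_lt (by omega)]
    split_ifs <;> omega

theorem dicycle_isStrongOfOrder {n : ℕ} (hn : 2 ≤ n) : IsStrongOfOrder n (dicycle n) := by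
  have hcard : Fintype.card (Fin n) = n := Fintype.card_fin n
  obtain ⟨hinj, hlt⟩ := injective_of_levels hcard (exists_dicycleLabel_eq n)
  have hadj := dicycle_adj_iff n
  obtain ⟨u, hu⟩ := exists_dicycleLabel_eq n 0 (by omega)
  have hto : ∀ m v, dicycleLabel n v = m → Relation.ReflTransGen (dicycle n).Adj v u := by
    intro m
    induction m with
    | zero => intro v hv; rw [hinj (hv.trans hu.symm)]
    | succ m ih =>
      intro v hv
      have := hlt v
      obtain ⟨w, hw⟩ := exists_dicycleLabel_eq n m (by omega)
      exact .head ((hadj v w).2 (by unfold dicycleRel; omega)) (ih w hw)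
  have hfrom : ∀ m v, dicycleLabel n v + m + 1 = n →
      Relation.ReflTransGen (dicycle n).Adj u v := by
    intro m
    induction m with
    | zero => exact fun v hv => .single ((hadj u v).2 (by unfold dicycleRel; omega))
    | succ m ih =>
      intro v hv
      obtain ⟨w, hw⟩ := exists_dicycleLabel_eq n (dicycleLabel n v + 1) (by omega)
      exact .tail (ih w (by omega)) ((hadj w v).2 (by unfold dicycleRel; omega))
  refine ⟨hcard, fun v hv => ?_,
    fun v w => (hto _ v rfl).trans (hfrom (n - 1 - dicycleLabel n w) w ?_)⟩
  · have := (hadj v v).1 hv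
    unfold dicycleRel at this
    omega
  · have := hlt w
    omega

theorem dicycle_alphaSpectralRadius_le {n : ℕ} (hn : 2 ≤ n) {α : ℝ} (hα0 : 0 ≤ α)
    (hα1 : α < 1) : alphaSpectralRadius α (dicycle n) ≤ ENNReal.ofReal 1 := by
  refine spectralRadius_le_of_mulVec_le (alphaMatrix_nonneg hα0 hα1 _) (x := fun _ => 1)
    (fun _ => one_pos) fun v => ?_
  rw [alphaMatrix_mulVec]
  obtain ⟨e1, e2⟩ := sum_out_eq_of_unique (G := dicycle n) (v := v)
    (w := ⟨((v : ℕ) + 1) % n, Nat.mod_lt _ (by omega)⟩) (fun z => by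
      rw [Fin.ext_iff]; rfl) (fun _ => (1 : ℝ))
  rw [e1, e2]
  norm_num

end Dicycle

/-! ### Digraphs with no, one, or several branching vertices -/

section Classification

variable {V : Type*} [Fintype V] {n : ℕ} {G : Digraph V}

theorem exists_unique_out_of_outdegree {v : V} (h : outdegree G v = 1) :
    ∃ w, ∀ z, G.Adj v z ↔ z = w := by
  classical
  obtain ⟨w, hw⟩ := Finset.card_eq_one.1 h
  exact ⟨w, fun z => by simpa using Finset.ext_iff.1 hw z⟩

theorem exists_two_out {v : V} (h : 2 ≤ outdegree G v) :
    ∃ w₁ w₂, w₁ ≠ w₂ ∧ G.Adj v w₁ ∧ G.Adj v w₂ := by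
  classical
  obtain ⟨w₁, h1, w₂, h2, hne⟩ := Finset.one_lt_card.1 h
  exact ⟨w₁, w₂, hne, by simpa using h1, by simpa using h2⟩

theorem IsStrongOfOrder.exists_adj (hG : IsStrongOfOrder n G) (hn : 2 ≤ n) (v : V) :
    (∃ w, G.Adj v w) ∧ ∃ w, G.Adj w v := by
  have : Nontrivial V := Fintype.one_lt_card_iff_nontrivial.1 (by rw [hG.1]; omega)
  obtain ⟨w, hw⟩ := exists_ne v
  constructor
  · rcases (hG.2.2 v w).cases_head with h | ⟨z, hz, -⟩
    · exact absurd h.symm hw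
    · exact ⟨z, hz⟩
  · rcases (hG.2.2 w v).cases_tail with h | ⟨z, -, hz⟩
    · exact absurd h.symm hw
    · exact ⟨z, hz⟩

theorem isomorphic_dicycle (hG : IsStrongOfOrder n G) (hn : 2 ≤ n)
    (h : ∀ v, outdegree G v = 1) : Isomorphic G (dicycle n) := by
  have : Nonempty V := Fintype.card_pos_iff.1 (by rw [hG.1]; omega)
  obtain ⟨u⟩ := ‹Nonempty V›
  choose f hf using fun v => exists_unique_out_of_outdegree (h v)
  -- Every vertex has an in-neighbour, so the successor map is surjective, hence a permutation.
  have hbij : Function.Bijective f := Finite.surjective_iff_bijective.1 fun w => by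
    obtain ⟨v, hv⟩ := (hG.exists_adj hn w).2
    exact ⟨v, ((hf v w).1 hv).symm⟩
  obtain ⟨d, hd0, hd⟩ := exists_level G.Adj (fun v => v = u) fun v => ⟨u, rfl, hG.2.2 v u⟩
  have hdf (v) (hv : d v ≠ 0) : d (f v) + 1 = d v := by
    obtain ⟨w, hw, h⟩ := hd v hv
    rwa [(hf v w).1 hw] at h
  have hdinj : Function.Injective d := by
    have key : ∀ m v w, d v = m → d w = m → v = w := by
      intro m
      induction m with
      | zero => intro v w hv hw; rw [(hd0 v).1 hv, (hd0 w).1 hw]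
      | succ m ih =>
        intro v w hv hw
        have h1 := hdf v (by omega)
        have h2 := hdf w (by omega)
        exact hbij.1 (ih _ _ (by omega) (by omega))
    exact fun v w hvw => key _ v w rfl hvw.symm
  have hlev : ∀ m < n, ∃ v, d v = m := by
    obtain ⟨v, -, hv⟩ := Finset.exists_max_image Finset.univ d ⟨u, Finset.mem_univ u⟩
    have hcard : Fintype.card V ≤ d v + 1 := by
      have := Finset.card_le_card_of_injOn (s := Finset.univ) (t := Finset.range (d v + 1)) d
        (fun w _ => by simpa [Nat.lt_succ_iff] using hv w (Finset.mem_univ w)) hdinj.injOn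
      simpa using this
    intro m hm
    exact exists_level_eq (fun v hv => (hd v hv).imp fun _ h => h.2) v m
      (by rw [hG.1] at hcard; omega)
  refine isomorphic_of_labels hG.1 (Fintype.card_fin n) hlev (exists_dicycleLabel_eq n) _
    (fun v w => ?_) (dicycle_adj_iff n)
  have hlt := (injective_of_levels hG.1 hlev).2
  rw [hf, ← hdinj.eq_iff]
  unfold dicycleRel
  by_cases hv : d v = 0
  -- The predecessor of the vertex at level `n - 1` must be at level 0, since otherwise its own
  -- level would be `n`.
  · obtain ⟨x, hx⟩ := hlev (n - 1) (by omega)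
    obtain ⟨y, rfl⟩ := hbij.2 x
    have hy : d y = 0 := by
      by_contra h
      have := hdf y h
      have := hlt y
      omega
    rw [hdinj (hv.trans hy.symm), hx]
    omega
  · have := hdf v hv
    omega

section Counting

variable {S : Finset V} {d : V → ℕ}

/-- The levels `1, …, d v` are all occupied by vertices outside `S`. -/
theorem card_add_level_le (hS : ∀ v, d v = 0 ↔ v ∈ S)
    (hd : ∀ v, d v ≠ 0 → ∃ w, d w + 1 = d v) (v : V) : S.card + d v ≤ Fintype.card V := by
  classical
  have h1 : d v ≤ Sᶜ.card := le_card_of_levels (d := fun x => d x - 1) fun m hm => by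
    obtain ⟨w, hw⟩ := exists_level_eq hd v (m + 1) hm
    refine ⟨w, ?_, by simp [hw]⟩
    rw [Finset.mem_compl, ← hS]; omega
  rw [Finset.card_compl] at h1
  have := Finset.card_le_univ S
  omega

/-- A repeated level wastes a vertex: the levels `1, …, d v` stay occupied outside `S` after `w` is
removed. -/
theorem card_add_level_lt (hS : ∀ v, d v = 0 ↔ v ∈ S)
    (hd : ∀ v, d v ≠ 0 → ∃ w, d w + 1 = d v) {v w : V} (hne : v ≠ w) (hvw : d v = d w)
    (h0 : d v ≠ 0) : S.card + d v < Fintype.card V := by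
  classical
  have hw : w ∈ Sᶜ := by rw [Finset.mem_compl, ← hS]; omega
  have h1 : d v ≤ (Sᶜ.erase w).card := le_card_of_levels (d := fun x => d x - 1) fun m hm => by
    by_cases hmv : m + 1 = d v
    · refine ⟨v, ?_, by omega⟩
      rw [Finset.mem_erase, Finset.mem_compl, ← hS]
      exact ⟨hne, h0⟩
    · obtain ⟨x, hx⟩ := exists_level_eq hd v (m + 1) hm
      refine ⟨x, ?_, by simp [hx]⟩
      rw [Finset.mem_erase, Finset.mem_compl, ← hS]
      exact ⟨by rintro rfl; omega, by omega⟩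
  rw [Finset.card_erase_of_mem hw, Finset.card_compl] at h1
  have h2 : 0 < Sᶜ.card := Finset.card_pos.2 ⟨w, hw⟩
  rw [Finset.card_compl] at h2
  omega

end Counting

open Classical in
theorem add_le_sum_out {x : V → ℝ} (hx : ∀ v, 0 < x v) {v w₁ w₂ : V} (hne : w₁ ≠ w₂)
    (h₁ : G.Adj v w₁) (h₂ : G.Adj v w₂) : x w₁ + x w₂ ≤ ∑ w with G.Adj v w, x w := by
  rw [← Finset.sum_pair hne]
  refine Finset.sum_le_sum_of_subset_of_nonneg (fun z hz => ?_) fun z _ _ => (hx z).le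
  rcases Finset.mem_insert.1 hz with rfl | hz
  · simpa using h₁
  · rw [Finset.mem_singleton.1 hz]; simpa using h₂

open Classical in
theorem add_lt_sum_out {x : V → ℝ} (hx : ∀ v, 0 < x v) {v w₁ w₂ w₃ : V} (hne : w₁ ≠ w₂)
    (h₁ : G.Adj v w₁) (h₂ : G.Adj v w₂) (h₃ : G.Adj v w₃) (h13 : w₃ ≠ w₁) (h23 : w₃ ≠ w₂) :
    x w₁ + x w₂ < ∑ w with G.Adj v w, x w := by
  rw [← Finset.sum_pair hne]
  refine Finset.sum_lt_sum_of_subset (i := w₃) (fun z hz => ?_) (by simpa using h₃)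
    (by simp [h13, h23]) (hx _) fun z _ _ => (hx z).le
  rcases Finset.mem_insert.1 hz with rfl | hz
  · simpa using h₁
  · rw [Finset.mem_singleton.1 hz]; simpa using h₂

/-- At least two branching vertices. -/
theorem lt_alphaSpectralRadius_of_two_branching [DecidableEq V] (hn : 4 ≤ n)
    (hG : IsStrongOfOrder n G) {u₁ u₂ : V} (hne : u₁ ≠ u₂) (hu₁ : 2 ≤ outdegree G u₁)
    (hu₂ : 2 ≤ outdegree G u₂) {α t lam : ℝ} (hα0 : 0 ≤ α) (hα1 : α < 1) (ht0 : 0 < t)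
    (ht1 : t < 1) (hlam : lam * t = α * t + (1 - α))
    (hE : lam = 2 * α + (1 - α) * (t ^ (n - 1) + t ^ (n - 3))) :
    ENNReal.ofReal lam < alphaSpectralRadius α G := by
  classical
  obtain ⟨d, hd0, hd⟩ := exists_level G.Adj (fun v => 2 ≤ outdegree G v)
    fun v => ⟨u₁, hu₁, hG.2.2 v u₁⟩
  let S : Finset V := Finset.univ.filter fun v => 2 ≤ outdegree G v
  have hS : ∀ v, d v = 0 ↔ v ∈ S := fun v => by simp [S, hd0]
  have hScard : 2 ≤ S.card := Finset.one_lt_card.2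
    ⟨u₁, (hS _).1 ((hd0 _).2 hu₁), u₂, (hS _).1 ((hd0 _).2 hu₂), hne⟩
  have hd' : ∀ v, d v ≠ 0 → ∃ w, d w + 1 = d v := fun v hv => (hd v hv).imp fun _ h => h.2
  have hmain (v) (hv : d v = 0) :
      t ^ (n - 1) + t ^ (n - 3) < ∑ w with G.Adj v w, t ^ d w := by
    obtain ⟨w₁, w₂, hw, h1, h2⟩ := exists_two_out ((hd0 v).1 hv)
    refine lt_of_lt_of_le ?_
      (add_le_sum_out (x := fun w => t ^ d w) (fun _ => pow_pos ht0 _) hw h1 h2)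
    have c1 := card_add_level_le hS hd' w₁
    have c2 := card_add_level_le hS hd' w₂
    have c3 := card_add_level_lt hS hd' hw
    rw [hG.1] at c1 c2 c3
    have hlt : t ^ (n - 1) < t ^ (n - 2) := pow_lt_pow_right_of_lt_one₀ ht0 ht1 (by omega)
    have hpow {p q : ℕ} (h : p ≤ q) : t ^ q ≤ t ^ p := pow_le_pow_of_le_one ht0.le ht1.le h
    -- Both levels are at most `n - 2` as `S` has two elements, and they cannot both equal `n - 2`.
    have : d w₁ ≤ n - 3 ∧ d w₂ ≤ n - 2 ∨ d w₁ ≤ n - 2 ∧ d w₂ ≤ n - 3 := by omega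
    rcases this with ⟨p1, p2⟩ | ⟨p1, p2⟩
    · linarith [hpow p1, hpow p2]
    · linarith [hpow p1, hpow p2]
  exact lt_alphaSpectralRadius hG.2.2 hα0 hα1 ht0 hlam hE hd
    (fun v hv => ⟨(hd0 v).1 hv, (hmain v hv).le⟩) ((hd0 u₁).2 hu₁) (hmain _ ((hd0 u₁).2 hu₁))

/-- Exactly one branching vertex. -/
theorem one_branching [DecidableEq V] (hn : 4 ≤ n)
    (hG : IsStrongOfOrder n G) {u : V} (hu : 2 ≤ outdegree G u)
    (huniq : ∀ v, v ≠ u → outdegree G v = 1)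
    (h21 : ¬ Isomorphic G (theta ![2, 1] ![n - 2])) (h22 : ¬ Isomorphic G (theta ![2, 2] ![n - 3]))
    {α t lam : ℝ} (hα0 : 0 ≤ α) (hα1 : α < 1) (ht0 : 0 < t)
    (ht1 : t < 1) (hlam : lam * t = α * t + (1 - α))
    (hE : lam = 2 * α + (1 - α) * (t ^ (n - 1) + t ^ (n - 3))) :
    ENNReal.ofReal lam ≤ alphaSpectralRadius α G ∧
      (¬ Isomorphic G (theta ![3, 1] ![n - 3]) →
        ENNReal.ofReal lam < alphaSpectralRadius α G) := by
  classical
  obtain ⟨d, hd0, hd⟩ := exists_level G.Adj (fun v => v = u) fun v => ⟨u, rfl, hG.2.2 v u⟩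
  have hd' : ∀ v, d v ≠ 0 → ∃ w, d w + 1 = d v := fun v hv => (hd v hv).imp fun _ h => h.2
  have hS : ∀ v, d v = 0 ↔ v ∈ ({u} : Finset V) := fun v => by rw [hd0, Finset.mem_singleton]
  have hle (v) : d v < n := by
    have := card_add_level_le hS hd' v
    rw [hG.1, Finset.card_singleton] at this
    omega
  have hout (v) (hv : d v ≠ 0) : ∃ w, (∀ z, G.Adj v z ↔ z = w) ∧ d w + 1 = d v := by
    obtain ⟨w, hw⟩ := exists_unique_out_of_outdegree (huniq v (mt (hd0 v).2 hv))
    obtain ⟨w', hw', h⟩ := hd v hv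
    exact ⟨w, hw, by rwa [← (hw w').1 hw']⟩
  have hlev {w : V} (hw : d w = n - 1) : ∀ m < n, ∃ v, d v = m := fun m hm =>
    exists_level_eq hd' w m (by omega)
  have hdu : d u = 0 := (hd0 u).2 rfl
  have hpos : ∀ v, 0 < t ^ d v := fun _ => pow_pos ht0 _
  by_cases hshort : ∃ w, G.Adj u w ∧ d w ≤ n - 3
  · obtain ⟨w, hw, hdw⟩ := hshort
    obtain ⟨w', hne, hw'⟩ : ∃ w', w ≠ w' ∧ G.Adj u w' := by
      obtain ⟨w₁, w₂, hne, h1, h2⟩ := exists_two_out hu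
      by_cases h : w = w₁
      · exact ⟨w₂, h ▸ hne, h2⟩
      · exact ⟨w₁, h, h1⟩
    have p1 : t ^ (n - 3) ≤ t ^ d w := pow_le_pow_of_le_one ht0.le ht1.le hdw
    have p2 : t ^ (n - 1) ≤ t ^ d w' :=
      pow_le_pow_of_le_one ht0.le ht1.le (by have := hle w'; omega)
    have hsum := add_le_sum_out hpos hne hw hw'
    have h2 : ∀ v, d v = 0 → 2 ≤ outdegree G v ∧
        t ^ (n - 1) + t ^ (n - 3) ≤ ∑ w with G.Adj v w, t ^ d w := by
      intro v hv
      rw [(hd0 v).1 hv]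
      exact ⟨hu, by linarith⟩
    refine ⟨le_alphaSpectralRadius hα0 hα1 ht0 hlam hE hd h2 u, fun h31 => ?_⟩
    refine lt_alphaSpectralRadius hG.2.2 hα0 hα1 ht0 hlam hE hd h2 hdu ?_
    by_contra hnot
    refine h31 ?_
    -- Without strictness every estimate is tight, which fixes both levels and excludes a third arc
    -- from `u`; level `n - 1` being occupied, `d` itself is a labelling.
    have q1 : d w = n - 3 := by
      by_contra h
      have : t ^ (n - 3) < t ^ d w := pow_lt_pow_right_of_lt_one₀ ht0 ht1 (by omega)
      linarith
    have q2 : d w' = n - 1 := by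
      by_contra h
      have : t ^ (n - 1) < t ^ d w' :=
        pow_lt_pow_right_of_lt_one₀ ht0 ht1 (by have := hle w'; omega)
      linarith
    have q3 : ∀ z, G.Adj u z ↔ z = w ∨ z = w' := by
      intro z
      refine ⟨fun hz => ?_, ?_⟩
      · by_contra! h
        have := add_lt_sum_out hpos hne hw hw' hz h.1 h.2
        linarith
      · rintro (rfl | rfl)
        · exact hw
        · exact hw'
    have hinj := (injective_of_levels hG.1 (hlev q2)).1
    refine isomorphic_theta (n := n) (c := d) (by simp; omega) (by simp) (by simp)
      (by simp; omega) hG.1 (hlev q2) fun v z => ?_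
    change _ ↔ thetaRel 3 1 (n - 3) (d v) (d z)
    have hz := hle z
    by_cases hv : d v = 0
    · rw [(hd0 v).1 hv, q3, ← hinj.eq_iff, ← hinj.eq_iff, q1, q2, hdu]
      unfold thetaRel; omega
    · obtain ⟨x, hx, hdx⟩ := hout v hv
      rw [hx, ← hinj.eq_iff]
      unfold thetaRel; omega
  -- All out-neighbours of `u` now lie on levels `n - 2` and `n - 1`. If level `n - 1` is occupied,
  -- all levels are distinct and `G` is `Θ̃(2, 1; n - 2)`; otherwise two of them share level `n -
  -- 2`, giving `Θ̃(2, 2; n - 3)`.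
  · push Not at hshort
    exfalso
    obtain ⟨w₁, w₂, hne, hw₁, hw₂⟩ := exists_two_out hu
    by_cases hlong : ∃ w, d w = n - 1
    · obtain ⟨w, hw⟩ := hlong
      refine h21 ?_
      have hinj := (injective_of_levels hG.1 (hlev hw)).1
      have a1 := hshort w₁ hw₁
      have a2 := hshort w₂ hw₂
      have b1 := hle w₁
      have b2 := hle w₂
      have hne' := hinj.ne hne
      refine isomorphic_theta (n := n) (c := d) (by simp; omega) (by simp) (by simp)
        (by simp; omega) hG.1 (hlev hw) fun v z => ?_
      change _ ↔ thetaRel 2 1 (n - 2) (d v) (d z)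
      have hz := hle z
      by_cases hv : d v = 0
      · rw [(hd0 v).1 hv, hdu]
        constructor
        · intro h
          have := hshort z h
          unfold thetaRel; omega
        · intro h
          have : d z = d w₁ ∨ d z = d w₂ := by unfold thetaRel at h; omega
          rcases this with h | h
          · rwa [hinj h]
          · rwa [hinj h]
      · obtain ⟨x, hx, hdx⟩ := hout v hv
        rw [hx, ← hinj.eq_iff]
        unfold thetaRel; omega
    · push Not at hlong
      refine h22 ?_
      have hle' (v) : d v ≤ n - 2 := by
        have := hle v
        have := hlong v
        omega
      have a1 : d w₁ = n - 2 := by have := hshort w₁ hw₁; have := hle' w₁; omega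
      have a2 : d w₂ = n - 2 := by have := hshort w₂ hw₂; have := hle' w₂; omega
      -- The tie at level `n - 2` is broken by moving `w₁` to the free label `n - 1`.
      let c : V → ℕ := fun v => if v = w₁ then n - 1 else d v
      have hc1 : c w₁ = n - 1 := if_pos rfl
      have hc {v : V} (hv : v ≠ w₁) : c v = d v := if_neg hv
      have hc' {v : V} (hv : d v ≠ n - 2) : c v = d v := hc fun h => hv (h ▸ a1)
      have hclev : ∀ m < n, ∃ v, c v = m := by
        intro m hm
        by_cases e1 : m = n - 1
        · exact ⟨w₁, hc1.trans e1.symm⟩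
        by_cases e2 : m = n - 2
        · exact ⟨w₂, (hc hne.symm).trans (a2.trans e2.symm)⟩
        obtain ⟨v, hv⟩ := exists_level_eq hd' w₁ m (by omega)
        exact ⟨v, (hc' (by omega)).trans hv⟩
      have hinj := (injective_of_levels hG.1 hclev).1
      refine isomorphic_theta (n := n) (c := c) (by simp; omega) (by simp) (by simp)
        (by simp; omega) hG.1 hclev fun v z => ?_
      change _ ↔ thetaRel 2 2 (n - 3) (c v) (c z)
      by_cases hv : d v = 0
      · have hcu : c u = 0 := (hc' (by omega)).trans hdu
        rw [(hd0 v).1 hv, hcu]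
        constructor
        · intro h
          have h1 := hshort z h
          have h2 := hle' z
          by_cases hz : z = w₁
          · rw [hz, hc1]; unfold thetaRel; omega
          · rw [hc hz]; unfold thetaRel; omega
        · intro h
          have : c z = c w₁ ∨ c z = c w₂ := by
            rw [hc1, hc hne.symm, a2]; unfold thetaRel at h; omega
          rcases this with h | h
          · rwa [hinj h]
          · rwa [hinj h]
      · obtain ⟨x, hx, hdx⟩ := hout v hv
        have h2 := hle' v
        have hcx : c x = d x := hc' (by omega)
        rw [hx, ← hinj.eq_iff, hcx]
        by_cases hvw : v = w₁
        · rw [hvw, hc1]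
          rw [hvw] at hdx
          unfold thetaRel; omega
        · rw [hc hvw]
          unfold thetaRel; omega

/-- Every strongly connected digraph other than the three exceptional ones has `α`-spectral radius
at least that of `Θ̃(3, 1; n - 3)`, strictly so unless it is that digraph. -/
theorem alphaSpectralRadius_of_not_exceptional [DecidableEq V] (hn : 4 ≤ n)
    (hG : IsStrongOfOrder n G) (hC : ¬ Isomorphic G (dicycle n))
    (h21 : ¬ Isomorphic G (theta ![2, 1] ![n - 2])) (h22 : ¬ Isomorphic G (theta ![2, 2] ![n - 3]))
    {α t lam : ℝ} (hα0 : 0 ≤ α) (hα1 : α < 1) (ht0 : 0 < t)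
    (ht1 : t < 1) (hlam : lam * t = α * t + (1 - α))
    (hE : lam = 2 * α + (1 - α) * (t ^ (n - 1) + t ^ (n - 3))) :
    ENNReal.ofReal lam ≤ alphaSpectralRadius α G ∧
      (¬ Isomorphic G (theta ![3, 1] ![n - 3]) →
        ENNReal.ofReal lam < alphaSpectralRadius α G) := by
  have hone (v) (hv : ¬ 2 ≤ outdegree G v) : outdegree G v = 1 := by
    obtain ⟨w, hw⟩ := (hG.exists_adj (by omega) v).1
    have := outdegree_pos hw
    omega
  obtain ⟨u, hu⟩ : ∃ u, 2 ≤ outdegree G u := by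
    by_contra! h
    exact hC (isomorphic_dicycle hG (by omega) fun v => hone v (by have := h v; omega))
  by_cases huniq : ∀ v, v ≠ u → outdegree G v = 1
  · exact one_branching hn hG hu huniq h21 h22 hα0 hα1 ht0 ht1 hlam hE
  · push Not at huniq
    obtain ⟨u', hne, hu'⟩ := huniq
    have h := lt_alphaSpectralRadius_of_two_branching hn hG hne.symm hu
      (not_imp_comm.1 (hone u') hu') hα0 hα1 ht0 ht1 hlam hE
    exact ⟨h.le, fun _ => h⟩

end Classification

end AlphaSpectral

/-! ### Comparison of the radii -/

theorem mainTheorem7 (n : ℕ) (hn : 4 ≤ n) (α : ℝ) (hα0 : 0 ≤ α) (hα1 : α < 1) :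
    -- the four digraphs are strongly connected digraphs on `n` vertices
    (AlphaSpectral.IsStrongOfOrder n (AlphaSpectral.dicycle n) ∧
      AlphaSpectral.IsStrongOfOrder n (AlphaSpectral.theta ![2, 1] ![n - 2]) ∧
      AlphaSpectral.IsStrongOfOrder n (AlphaSpectral.theta ![2, 2] ![n - 3]) ∧
      AlphaSpectral.IsStrongOfOrder n (AlphaSpectral.theta ![3, 1] ![n - 3])) ∧
    -- the three smallest values, each attained only by the named digraph
    (AlphaSpectral.alphaSpectralRadius α (AlphaSpectral.dicycle n) <
        AlphaSpectral.alphaSpectralRadius α (AlphaSpectral.theta ![2, 1] ![n - 2]) ∧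
      AlphaSpectral.alphaSpectralRadius α (AlphaSpectral.theta ![2, 1] ![n - 2]) <
        AlphaSpectral.alphaSpectralRadius α (AlphaSpectral.theta ![2, 2] ![n - 3]) ∧
      ∀ (V : Type*) [Fintype V] [DecidableEq V] (G : Digraph V),
        AlphaSpectral.IsStrongOfOrder n G →
        ¬ AlphaSpectral.Isomorphic G (AlphaSpectral.dicycle n) →
        ¬ AlphaSpectral.Isomorphic G (AlphaSpectral.theta ![2, 1] ![n - 2]) →
        ¬ AlphaSpectral.Isomorphic G (AlphaSpectral.theta ![2, 2] ![n - 3]) →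
        AlphaSpectral.alphaSpectralRadius α (AlphaSpectral.theta ![2, 2] ![n - 3]) <
          AlphaSpectral.alphaSpectralRadius α G) ∧
    -- the fourth smallest value, for `α ≤ 1 / 2`
    (α ≤ 1 / 2 →
      AlphaSpectral.alphaSpectralRadius α (AlphaSpectral.theta ![2, 2] ![n - 3]) <
        AlphaSpectral.alphaSpectralRadius α (AlphaSpectral.theta ![3, 1] ![n - 3]) ∧
      ∀ (V : Type*) [Fintype V] [DecidableEq V] (G : Digraph V),
        AlphaSpectral.IsStrongOfOrder n G →
        ¬ AlphaSpectral.Isomorphic G (AlphaSpectral.dicycle n) →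
        ¬ AlphaSpectral.Isomorphic G (AlphaSpectral.theta ![2, 1] ![n - 2]) →
        ¬ AlphaSpectral.Isomorphic G (AlphaSpectral.theta ![2, 2] ![n - 3]) →
        ¬ AlphaSpectral.Isomorphic G (AlphaSpectral.theta ![3, 1] ![n - 3]) →
        AlphaSpectral.alphaSpectralRadius α (AlphaSpectral.theta ![3, 1] ![n - 3]) <
          AlphaSpectral.alphaSpectralRadius α G) := by
  have s0 := AlphaSpectral.dicycle_isStrongOfOrder (n := n) (by omega)
  have k21 : AlphaSpectral.IsStrongOfOrder n (AlphaSpectral.theta ![2, 1] ![n - 2]) :=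
    AlphaSpectral.theta_isStrongOfOrder (by simp; omega) (by simp) (by simp) (by simp; omega)
  have k22 : AlphaSpectral.IsStrongOfOrder n (AlphaSpectral.theta ![2, 2] ![n - 3]) :=
    AlphaSpectral.theta_isStrongOfOrder (by simp; omega) (by simp) (by simp) (by simp; omega)
  have k31 : AlphaSpectral.IsStrongOfOrder n (AlphaSpectral.theta ![3, 1] ![n - 3]) :=
    AlphaSpectral.theta_isStrongOfOrder (by simp; omega) (by simp) (by simp) (by simp; omega)
  obtain ⟨t₂, lam₂, p₂, q₂, hlam₂, hE₂⟩ :=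
    AlphaSpectral.exists_perron_parameter hα1 (n - 1) (n - 2)
  obtain ⟨t₃, lam₃, p₃, q₃, hlam₃, hE₃⟩ :=
    AlphaSpectral.exists_perron_parameter hα1 (n - 2) (n - 2)
  obtain ⟨t₄, lam₄, p₄, q₄, hlam₄, hE₄⟩ :=
    AlphaSpectral.exists_perron_parameter hα1 (n - 1) (n - 3)
  have u21 := AlphaSpectral.theta_alphaSpectralRadius_le (k := ![2, 1]) (l := ![n - 2]) (n := n)
    (by simp; omega) (by simp) (by simp) (by simp; omega) hα0 hα1 p₂ hlam₂
    (by simp; omega) (by simp) hE₂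
  have u22 := AlphaSpectral.theta_alphaSpectralRadius_le (k := ![2, 2]) (l := ![n - 3]) (n := n)
    (by simp; omega) (by simp) (by simp) (by simp; omega) hα0 hα1 p₃ hlam₃
    (by simp; omega) (by simp; omega) hE₃
  have u31 := AlphaSpectral.theta_alphaSpectralRadius_le (k := ![3, 1]) (l := ![n - 3]) (n := n)
    (by simp; omega) (by simp) (by simp) (by simp; omega) hα0 hα1 p₄ hlam₄
    (by simp; omega) (by simp) hE₄
  have l21 : ENNReal.ofReal 1 <
      AlphaSpectral.alphaSpectralRadius α (AlphaSpectral.theta ![2, 1] ![n - 2]) := by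
    have h1 : 0 < 1 - α := by linarith
    -- With `t = 1` the test vector is constant and `lam = 1`; `E` solves `1 = 2 * α + (1 - α) * E`
    -- and is less than 2.
    refine AlphaSpectral.lt_theta_alphaSpectralRadius (n := n) (t := 1)
      (E := (1 - 2 * α) / (1 - α)) (e₁ := n - 1) (e₂ := n - 2)
      (by simp; omega) (by simp) (by simp) (by simp; omega) hα0 hα1 one_pos
      (by ring) ?_ (by simp; omega) (by simp) ?_
    · rw [mul_div_cancel₀ _ h1.ne']; ring
    · rw [one_pow, one_pow, div_lt_iff₀ h1]; linarith
  have l22 : ENNReal.ofReal lam₂ <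
      AlphaSpectral.alphaSpectralRadius α (AlphaSpectral.theta ![2, 2] ![n - 3]) := by
    refine AlphaSpectral.lt_theta_alphaSpectralRadius (n := n) (e₁ := n - 2) (e₂ := n - 2)
      (by simp; omega) (by simp) (by simp) (by simp; omega) hα0 hα1 p₂ hlam₂ hE₂
      (by simp; omega) (by simp; omega) ?_
    have : t₂ ^ (n - 1) < t₂ ^ (n - 2) := pow_lt_pow_right_of_lt_one₀ p₂ q₂ (by omega)
    linarith
  have l31 : ENNReal.ofReal lam₃ <
      AlphaSpectral.alphaSpectralRadius α (AlphaSpectral.theta ![3, 1] ![n - 3]) := by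
    refine AlphaSpectral.lt_theta_alphaSpectralRadius (n := n) (e₁ := n - 1) (e₂ := n - 3)
      (by simp; omega) (by simp) (by simp) (by simp; omega) hα0 hα1 p₃ hlam₃ hE₃
      (by simp; omega) (by simp) ?_
    obtain ⟨m, rfl⟩ : ∃ m, n = m + 3 := ⟨n - 3, by omega⟩
    -- This is the gap `t ^ (n - 1) + t ^ (n - 3) - 2 * t ^ (n - 2)` at `t = t₃`.
    have h : 0 < t₃ ^ m * (1 - t₃) ^ 2 := mul_pos (pow_pos p₃ m) (pow_pos (by linarith) 2)
    have e₁ : m + 3 - 1 = m + 2 := by omega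
    have e₂ : m + 3 - 2 = m + 1 := by omega
    rw [e₁, e₂, Nat.add_sub_cancel]
    linear_combination h
  have h34 := u22.trans_lt l31
  refine ⟨⟨s0, k21, k22, k31⟩, ⟨?_, u21.trans_lt l22, fun V _ _ G hG hC h21 h22 => ?_⟩,
    fun _ => ⟨h34, fun V _ _ G hG hC h21 h22 h31 => ?_⟩⟩
  · exact (AlphaSpectral.dicycle_alphaSpectralRadius_le (by omega) hα0 hα1).trans_lt l21
  · exact h34.trans_le (u31.trans (AlphaSpectral.alphaSpectralRadius_of_not_exceptional hn hG hC h21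
      h22 hα0 hα1 p₄ q₄ hlam₄ hE₄).1)
  · exact u31.trans_lt ((AlphaSpectral.alphaSpectralRadius_of_not_exceptional hn hG hC h21
      h22 hα0 hα1 p₄ q₄ hlam₄ hE₄).2 h31)
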